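/- **Model.** Let $V$ be a static set of $n\ge 2$ anonymous nodes. In each round $r=0,1,2,\dots$ there is a simple undirected graph $\mathcal G_r$ on $V$ in which the edges at each node $v$ carry distinct port labels $0,\dots,\deg_r(v)-1$ (the two labels of an edge, and the labels in different rounds, are unrelated). The dynamic graph is *1-Interval Connected*: every $\mathcal G_r$ is connected; otherwise it is arbitrary. There are $k=n-1$ agents with identifiers $1,\dots,n-1$, placed arbitrarily on the nodes. An agent knows its own identifier but neither $n$ nor $k$; between rounds it keeps only a bit string (which initially encodes its identifier) and a bit saying whether it has terminated. In each synchronous round every agent that has not terminated (i) broadcasts a message, received by all agents in its connected component of $\mathcal G_r$ (global communication), (ii) computes, from its memory, the received messages and its 1-hop view (the port-labelled subgraph induced by its node and the neighbours, with the agents on each of these nodes), its new memory, whether to move and through which port, and whether to terminate, and (iii) moves. The running time is the number of rounds until the last agent has terminated. A node without agents is a *hole*; a node with at least two agents is a *multinode*. **DISP (one round).** In each connected component of the subgraph of $\mathcal G_r$ induced by the nodes with agents that contains a multinode, let $w_1$ be the multinode holding the least identifier among the agents on multinodes of that component, and let $w_1,w_2,\dots,w_p$ be a shortest path with $w_2,\dots,w_{p-1}$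 occupied and $w_p$ a hole (ties broken by least identifiers, and by the least port for the hole). For each $j<p$ the agent with least identifier on $w_j$ moves to $w_{j+1}$. **Algorithm.** In each round, every agent broadcasts its identifier and its 1-hop information, including the number of agents on its node. If an agent is on a multinode or hears of one, it executes one round of DISP. Otherwise it moves to a neighbouring hole (through the least port leading to a hole), if there is one, and terminates in this round. **Theorem.** There are constants $c,C>0$ such that for every $n\ge 2$ and every set $V$ of $n$ nodes: 1. for every 1-Interval Connected dynamic graph on $V$ and every initial placement of the $n-1$ agents, all agents terminate, the running time $t$ is at most $Cn$, every node of $V$ has been visited by at least one agent by then, and every agent uses at most $C\log_2 n$ bits of memory in every round. Moreover, at the beginning of the last round $t-1$ the agents are on pairwise distinct nodes, and during that round an agent moves into the remaining hole; 2. there are a 1-Interval Connected dynamic graph on $V$ and an initial placement for which the running time is at least $cn$. So the algorithm solves exploration with termination in $\Theta(n)$ rounds with $O(\log n)$ bits per agent. -/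

import Mathlib

/-! ## Dynamic port-labelled graphs -/

/-- A graph with port labels. The entry with index `p` of `nbrs v` is the neighbour of `v` behind
port `p`, so the ports of `v` are `0, …, deg v - 1` and the two labels of an edge are unrelated. -/
structure PortGraph (V : Type*) where
  graph : SimpleGraph V
  nbrs : V → List V
  nodup_nbrs : ∀ v, (nbrs v).Nodup
  mem_nbrs : ∀ v w, w ∈ nbrs v ↔ graph.Adj v w

/-- A dynamic graph: one port-labelled graph per round, on a static set of nodes. -/
abbrev DynamicGraph (V : Type*) := ℕ → PortGraph V

/-- `T`-Interval Connectivity: over any `T` consecutive rounds the common edges connect all nodes. -/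
def DynamicGraph.IntervalConnected {V : Type*} (G : DynamicGraph V) (T : ℕ) : Prop :=
  ∀ r : ℕ, (⨅ i : Fin T, (G (r + i)).graph).Connected

/-! ## Agents: 1-hop visibility, global communication, memory -/

/-- What an agent sees of the neighbour behind one of its ports. -/
structure NbrView where
  /-- identifiers of the agents on that neighbour; the neighbour is a hole iff this is empty -/
  agents : Finset ℕ
  /-- port, at the neighbour, of the edge back to the observer's node -/
  back : Option ℕ
  /-- entry `q`: port, at the neighbour, of its edge to the observer's neighbour behind port `q`
  (`none` if there is no such edge) -/
  across : List (Option ℕ)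

/-- The 1-hop view: the agents on the observer's own node (the observer included) and, port by port,
its neighbours, with the port-labelled subgraph that they induce. -/
structure LocalView where
  here : Finset ℕ
  nbrs : List NbrView

/-- The result of the Compute phase of a round. -/
structure Decision where
  /-- the content of the memory that is kept for the next round -/
  mem : List Bool
  /-- the port to leave through, `none` for staying -/
  move : Option ℕ
  /-- whether the agent terminates at the end of this round -/
  halt : Bool

/-- A deterministic algorithm, the same for all agents, all graphs and all numbers of agents. The only
thing an agent keeps between rounds is a bit string. Its identifier is available only through the
initial content of that string, and neither `n` nor `k` is. In every round an agent broadcasts a message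
and then decides from its memory, its 1-hop view and the messages received. -/
structure AgentAlgorithm where
  Msg : Type
  init : ℕ → List Bool
  broadcast : List Bool → LocalView → Msg
  compute : List Bool → LocalView → List Msg → Decision

/-- A configuration of `k` agents at the beginning of a round. Agent `i` has identifier `i + 1`. -/
structure Config (V : Type*) (k : ℕ) where
  pos : Fin k → V
  mem : Fin k → List Bool
  halted : Fin k → Bool

namespace Config

variable {V : Type*} {k : ℕ}

/-- The number of bits that agent `i` stores: its memory and one bit for being terminated or not. -/
def bits (c : Config V k) (i : Fin k) : ℕ := (c.mem i).length + 1

open Classical in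
/-- The identifiers of the agents on node `v`. -/
noncomputable def agentsAt (c : Config V k) (v : V) : Finset ℕ :=
  (Finset.univ.filter fun i => c.pos i = v).image fun i => (i : ℕ) + 1

open Classical in
/-- The 1-hop view from node `v` in the graph `H` of the current round. -/
noncomputable def viewAt (c : Config V k) (H : PortGraph V) (v : V) : LocalView where
  here := c.agentsAt v
  nbrs := (H.nbrs v).map fun w =>
    { agents := c.agentsAt w
      back := (H.nbrs w).idxOf? v
      across := (H.nbrs v).map fun u => (H.nbrs w).idxOf? u }

open Classical in
/-- Global communication: agent `i` receives the messages of all agents (itself included) that have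
not terminated and lie in its connected component of `H`, in the order of their identifiers. -/
noncomputable def received (A : AgentAlgorithm) (c : Config V k) (H : PortGraph V) (i : Fin k) :
    List A.Msg :=
  ((List.finRange k).filter fun j =>
      decide (c.halted j = false ∧ H.graph.Reachable (c.pos i) (c.pos j))).map
    fun j => A.broadcast (c.mem j) (c.viewAt H (c.pos j))

/-- What agent `i` computes in a round with graph `H`. -/
noncomputable def decision (A : AgentAlgorithm) (c : Config V k) (H : PortGraph V) (i : Fin k) :
    Decision :=
  A.compute (c.mem i) (c.viewAt H (c.pos i)) (c.received A H i)

/-- The node that is reached from `v` through port `p`. -/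
def moveFrom (H : PortGraph V) (v : V) : Option ℕ → V
  | none => v
  | some p => ((H.nbrs v)[p]?).getD v

/-- One synchronous Communicate–Compute–Move round. A terminated agent does nothing any more. -/
noncomputable def next (A : AgentAlgorithm) (c : Config V k) (H : PortGraph V) : Config V k where
  pos i := if c.halted i then c.pos i else moveFrom H (c.pos i) (c.decision A H i).move
  mem i := if c.halted i then c.mem i else (c.decision A H i).mem
  halted i := if c.halted i then true else (c.decision A H i).halt

end Config

namespace AgentAlgorithm

variable {V : Type*} {k : ℕ}

/-- The configuration at the beginning of round `r` (that is, after `r` rounds). -/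
noncomputable def run (A : AgentAlgorithm) (G : DynamicGraph V) (start : Fin k → V) : ℕ → Config V k
  | 0 => { pos := start, mem := fun i => A.init (i + 1), halted := fun _ => false }
  | r + 1 => (A.run G start r).next A (G r)

/-- The running time: `t` is the number of rounds until the last agent has terminated. -/
def RunningTime (A : AgentAlgorithm) (G : DynamicGraph V) (start : Fin k → V) (t : ℕ) : Prop :=
  IsLeast {s : ℕ | ∀ i, (A.run G start s).halted i = true} t

/-- Within the first `t` rounds every node is visited by at least one agent. -/
def ExploresBy (A : AgentAlgorithm) (G : DynamicGraph V) (start : Fin k → V) (t : ℕ) : Prop :=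
  ∀ v : V, ∃ r ≤ t, ∃ i, (A.run G start r).pos i = v

end AgentAlgorithm

/-! ## The subroutine DISP and the exploration algorithm -/

/-- The message that an agent broadcasts: its identifier and its 1-hop information. -/
structure Report where
  id : ℕ
  view : LocalView

namespace Report

/-- The number of agents on the sender's node. -/
def count (r : Report) : ℕ := r.view.here.card

/-- The sender has the least identifier on its node; such a report stands for the node. -/
def isLeader (r : Report) : Bool := decide (∀ j ∈ r.view.here, r.id ≤ j)

/-- The sender of `s` is on a neighbouring node. -/
def sees (r s : Report) : Bool := r.view.nbrs.any fun w => decide (s.id ∈ w.agents)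

/-- The port that leads to the sender of `s`. -/
def portTo (r s : Report) : ℕ := r.view.nbrs.findIdx fun w => decide (s.id ∈ w.agents)

end Report

/-- The smallest port that leads to a hole, if there is one. -/
def LocalView.holePort (w : LocalView) : Option ℕ := w.nbrs.findIdx? fun u => decide (u.agents = ∅)

namespace DISP

/-! In what follows `L` lists one report for each occupied node. -/

/-- From the node of `r` some hole is at most `j + 1` steps away along occupied nodes. -/
def nearHole (L : List Report) : ℕ → Report → Bool
  | 0, r => r.view.holePort.isSome
  | j + 1, r => nearHole L j r || L.any fun s => r.sees s && nearHole L j s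

/-- A shortest sliding path from the node of `r` along occupied nodes to a hole at most `j + 1` steps
away: for each node of the path except the hole, the least agent there and the port it takes. Ties are
broken by the least identifier for occupied nodes and by the least port for holes. -/
def slidingPath (L : List Report) : ℕ → Report → List (ℕ × ℕ)
  | 0, r =>
    match r.view.holePort with
    | none => []
    | some p => [(r.id, p)]
  | j + 1, r =>
    if nearHole L j r then slidingPath L j r
    else
      match L.find? fun s => r.sees s && nearHole L j s with
      | none => []
      | some s => (r.id, r.portTo s) :: slidingPath L j s

/-- A walk of at most `j` steps along occupied nodes leads from the node of `r` to that of `s`. -/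
def joined (L : List Report) : ℕ → Report → Report → Bool
  | 0, r, s => decide (r.id = s.id)
  | j + 1, r, s => joined L j r s || L.any fun u => r.sees u && joined L j u s

/-- The node of `r` is a multinode and holds the least agent among all agents on multinodes of its
connected component of the subgraph induced by the occupied nodes. -/
def isRoot (L : List Report) (r : Report) : Bool :=
  decide (1 < r.count) &&
    L.all fun s => !(decide (1 < s.count) && joined L L.length r s) || decide (r.id ≤ s.id)

/-- One round of DISP: in every connected component of occupied nodes that has a multinode, slide one
agent per node along one path from a multinode to a hole. The result is the port through which the agent
`a` moves, if it is to move. -/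
def port (reports : List Report) (a : ℕ) : Option ℕ :=
  let L := reports.filter Report.isLeader
  (((L.filter (isRoot L)).flatMap (slidingPath L L.length)).find?
    fun m => decide (m.1 = a)).map Prod.snd

end DISP

/-- The identifier that a memory content encodes in binary. -/
def decodeId (m : List Bool) : ℕ := m.foldr Nat.bit 0

/-- Exploration with termination. The memory holds the identifier only. As long as there is a multinode,
execute a round of DISP; otherwise move to a neighbouring hole, if there is one, and terminate. -/
def explorationAlgorithm : AgentAlgorithm where
  Msg := Report
  init a := Nat.bits a
  broadcast m w := ⟨decodeId m, w⟩
  compute m w msgs :=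
    if decide (1 < w.here.card) || msgs.any (fun r => decide (1 < r.count)) then
      { mem := m, move := DISP.port msgs (decodeId m), halt := false }
    else
      { mem := m, move := w.holePort, halt := true }

/-! Since there are fewer agents than nodes, a hole always exists, and connectivity leads every
occupied node to one along a path of occupied nodes. A round of DISP that starts with a multinode
strictly enlarges the set of occupied nodes. A sliding path starts on a multinode, which keeps an
agent, each later node on it receives the agent of its predecessor, and its last move enters a hole
(`exists_dispPos_eq`, `exists_dispPos_hole`). The number of occupied nodes starts at 1 or more and
never exceeds `k`, so the agents are dispersed after at most `k - 1` rounds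
(`exists_first_injective`).

Every round's graph is connected, so all agents hear each other and detect dispersion in the same
round. Then exactly one hole remains; it has an occupied neighbour, whose agent moves in while
everyone terminates (`IsActive.exists_next_pos_eq`).

For the lower bound, a node loses at most its least agent per round of DISP (`card_filter_pos_le`).
If all agents start on one node, dispersing them takes at least `k - 1` rounds, whatever the graphs
are. -/

namespace Config

/-! ### Views, leaders and ports in terms of agent positions. -/

variable {V : Type*} {k : ℕ}

@[simp]
theorem mem_agentsAt (c : Config V k) (v : V) (a : ℕ) :
    a ∈ c.agentsAt v ↔ ∃ i : Fin k, c.pos i = v ∧ (i : ℕ) + 1 = a := by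
  simp [agentsAt]

theorem succ_mem_agentsAt (c : Config V k) (v : V) (i : Fin k) :
    (i : ℕ) + 1 ∈ c.agentsAt v ↔ c.pos i = v := by
  simp only [mem_agentsAt]
  constructor
  · rintro ⟨j, hj, h⟩
    obtain rfl : j = i := Fin.ext (by omega)
    exact hj
  · exact fun h => ⟨i, h, rfl⟩

theorem agentsAt_eq_empty (c : Config V k) (v : V) :
    c.agentsAt v = ∅ ↔ ∀ i, c.pos i ≠ v := by
  simp [Finset.eq_empty_iff_forall_notMem]

theorem one_lt_card_agentsAt (c : Config V k) (v : V) :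
    1 < (c.agentsAt v).card ↔ ∃ i j, c.pos i = v ∧ c.pos j = v ∧ i ≠ j := by
  rw [Finset.one_lt_card]
  constructor
  · rintro ⟨a, ha, b, hb, hab⟩
    obtain ⟨i, hi, rfl⟩ := (mem_agentsAt _ _ _).1 ha
    obtain ⟨j, hj, rfl⟩ := (mem_agentsAt _ _ _).1 hb
    exact ⟨i, j, hi, hj, by rintro rfl; exact hab rfl⟩
  · rintro ⟨i, j, hi, hj, hij⟩
    refine ⟨i + 1, (succ_mem_agentsAt _ _ _).2 hi, j + 1, (succ_mem_agentsAt _ _ _).2 hj, ?_⟩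
    intro h
    exact hij (Fin.ext (by omega))

/-- The report that agent `i` broadcasts when its memory encodes its identifier. -/
noncomputable def report (c : Config V k) (H : PortGraph V) (i : Fin k) : Report :=
  ⟨i + 1, c.viewAt H (c.pos i)⟩

/-- Agent `i` has the least identifier on its node. -/
def IsLeader (c : Config V k) (i : Fin k) : Prop := ∀ j, c.pos j = c.pos i → i ≤ j

/-- The reports of the agents with the least identifiers on their nodes. -/
noncomputable def leaderReports (c : Config V k) (H : PortGraph V) : List Report :=
  ((List.finRange k).map (c.report H)).filter Report.isLeader

theorem isLeader_report (c : Config V k) (H : PortGraph V) (i : Fin k) :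
    (c.report H i).isLeader = true ↔ c.IsLeader i := by
  rw [Report.isLeader, decide_eq_true_iff]
  simp only [report, viewAt, mem_agentsAt, IsLeader]
  constructor
  · intro h j hj
    have := h _ ⟨j, hj, rfl⟩
    exact Fin.le_def.2 (by omega)
  · rintro h _ ⟨j, hj, rfl⟩
    have := Fin.le_def.1 (h j hj)
    omega

theorem mem_leaderReports (c : Config V k) (H : PortGraph V) (r : Report) :
    r ∈ c.leaderReports H ↔ ∃ i, c.IsLeader i ∧ c.report H i = r := by
  simp only [leaderReports, List.mem_filter, List.mem_map, List.mem_finRange, true_and]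
  constructor
  · rintro ⟨⟨i, rfl⟩, h⟩
    exact ⟨i, (c.isLeader_report H i).1 h, rfl⟩
  · rintro ⟨i, h, rfl⟩
    exact ⟨⟨i, rfl⟩, (c.isLeader_report H i).2 h⟩

theorem exists_isLeader (c : Config V k) (i : Fin k) :
    ∃ j, c.pos j = c.pos i ∧ c.IsLeader j := by
  classical
  let s := Finset.univ.filter fun j => c.pos j = c.pos i
  have hs : s.Nonempty := ⟨i, by simp [s]⟩
  have h := s.min'_mem hs
  refine ⟨s.min' hs, by simpa [s] using h, fun j hj => s.min'_le j ?_⟩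
  have h' : c.pos (s.min' hs) = c.pos i := by simpa [s] using h
  simp [s, hj, h']

theorem IsLeader.eq {c : Config V k} {i j : Fin k} (hi : c.IsLeader i) (hj : c.IsLeader j)
    (h : c.pos i = c.pos j) : i = j :=
  le_antisymm (hi j h.symm) (hj i h)

theorem sees_report (c : Config V k) (H : PortGraph V) (i j : Fin k) :
    (c.report H i).sees (c.report H j) = true ↔ H.graph.Adj (c.pos i) (c.pos j) := by
  simp only [Report.sees, report, viewAt, List.any_map, List.any_eq_true, Function.comp,
    ← H.mem_nbrs]
  constructor
  · rintro ⟨w, hw, h⟩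
    rwa [(succ_mem_agentsAt _ _ _).1 (of_decide_eq_true h)]
  · exact fun h => ⟨_, h, decide_eq_true ((succ_mem_agentsAt _ _ _).2 rfl)⟩

theorem moveFrom_portTo (c : Config V k) (H : PortGraph V) (i j : Fin k)
    (h : H.graph.Adj (c.pos i) (c.pos j)) :
    moveFrom H (c.pos i) (some ((c.report H i).portTo (c.report H j))) = c.pos j := by
  set p := (c.report H i).portTo (c.report H j) with hp
  have hp' : p = (H.nbrs (c.pos i)).findIdx (fun w => decide ((j : ℕ) + 1 ∈ c.agentsAt w)) := by
    rw [hp]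
    simp only [Report.portTo, report, viewAt, List.findIdx_map]
    rfl
  -- `findIdx` returns the length of the list when nothing matches, and `moveFrom` then stays put;
  -- adjacency excludes this.
  have hlt : p < (H.nbrs (c.pos i)).length := by
    rw [hp']
    refine List.findIdx_lt_length_of_exists ⟨c.pos j, (H.mem_nbrs _ _).2 h, ?_⟩
    simp only [decide_eq_true_eq, succ_mem_agentsAt]
  have hget := List.findIdx_getElem (w := hp' ▸ hlt)
  simp only [← hp', decide_eq_true_eq, succ_mem_agentsAt] at hget
  simp [moveFrom, hlt, hget]

theorem holePort_eq (c : Config V k) (H : PortGraph V) (v : V) :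
    (c.viewAt H v).holePort =
      (H.nbrs v).findIdx? (fun w => decide (c.agentsAt w = ∅)) := by
  simp only [LocalView.holePort, viewAt, List.findIdx?_map]
  rfl

theorem moveFrom_holePort {c : Config V k} {H : PortGraph V} {v : V} {p : ℕ}
    (h : (c.viewAt H v).holePort = some p) : ∀ i, c.pos i ≠ moveFrom H v (some p) := by
  rw [holePort_eq, List.findIdx?_eq_some_iff_getElem] at h
  obtain ⟨hlt, hw, -⟩ := h
  rw [decide_eq_true_eq, agentsAt_eq_empty] at hw
  simpa [moveFrom, hlt] using hw

theorem isSome_holePort {c : Config V k} {H : PortGraph V} {v w : V} (hvw : H.graph.Adj v w)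
    (hw : ∀ i, c.pos i ≠ w) : (c.viewAt H v).holePort.isSome = true := by
  rw [holePort_eq, List.findIdx?_isSome, List.any_eq_true]
  exact ⟨w, (H.mem_nbrs _ _).2 hvw, by simpa [agentsAt_eq_empty] using hw⟩

end Config

/-! ### Sliding paths, for an arbitrary list of reports. -/

namespace DISP

/-- Once a bound suffices, every larger bound falls back on it through the first branch of the
recursion. Hence a sliding path depends only on its first node, which makes overlapping paths agree
from a common node onwards. -/
theorem nearHole_slidingPath_mono {L : List Report} {j j' : ℕ} {r : Report} (hj : j ≤ j')
    (h : nearHole L j r = true) :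
    nearHole L j' r = true ∧ slidingPath L j' r = slidingPath L j r := by
  induction j', hj using Nat.le_induction with
  | base => exact ⟨h, rfl⟩
  | succ m _ ih => simp [nearHole, slidingPath, ih.1, ih.2]

theorem slidingPath_congr {L : List Report} {j j' : ℕ} {r : Report}
    (h : nearHole L j r = true) (h' : nearHole L j' r = true) :
    slidingPath L j r = slidingPath L j' r := by
  rcases le_total j j' with hj | hj
  · exact (nearHole_slidingPath_mono hj h).2.symm
  · exact (nearHole_slidingPath_mono hj h').2

/-- A sliding path either consists of a single step into a hole, or it continues with the sliding
path of a neighbouring occupied node. -/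
theorem slidingPath_cases {L : List Report} {j : ℕ} {r : Report} (h : nearHole L j r = true) :
    (∃ p, r.view.holePort = some p ∧ slidingPath L j r = [(r.id, p)]) ∨
      ∃ s ∈ L, ∃ i < j, r.sees s = true ∧ nearHole L i s = true ∧
        slidingPath L j r = (r.id, r.portTo s) :: slidingPath L i s := by
  induction j with
  | zero =>
    obtain ⟨p, hp⟩ := Option.isSome_iff_exists.1 h
    exact .inl ⟨p, hp, by simp [slidingPath, hp]⟩
  | succ j ih =>
    by_cases hj : nearHole L j r = true
    · rw [(nearHole_slidingPath_mono (Nat.le_succ j) hj).2]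
      refine (ih hj).imp_right ?_
      rintro ⟨s, hs, i, hi, h⟩
      exact ⟨s, hs, i, by omega, h⟩
    · right
      simp only [nearHole, hj, Bool.false_or] at h
      cases hf : L.find? fun s => r.sees s && nearHole L j s with
      | none =>
        rw [List.find?_eq_none] at hf
        obtain ⟨s, hs, hs'⟩ := List.any_eq_true.1 h
        exact absurd hs' (hf s hs)
      | some s =>
        have hs := List.find?_some hf
        rw [Bool.and_eq_true] at hs
        exact ⟨s, List.mem_of_find?_eq_some hf, j, by omega, hs.1, hs.2, by
          simp [slidingPath, hj, hf]⟩

/-- Each entry of a sliding path is the first entry of another one; apart from the first entry, it is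
preceded by an entry that leads to it. -/
theorem mem_slidingPath {L : List Report} {j : ℕ} {r : Report} (hr : r ∈ L)
    (h : nearHole L j r = true) {m : ℕ × ℕ} (hm : m ∈ slidingPath L j r) :
    ∃ s ∈ L, s.id = m.1 ∧ (∃ i, nearHole L i s = true ∧ (slidingPath L i s).head? = some m) ∧
      (s = r ∨ ∃ u ∈ L, u.sees s = true ∧ (u.id, u.portTo s) ∈ slidingPath L j r) := by
  induction j using Nat.strong_induction_on generalizing r with
  | _ j ih =>
    rcases slidingPath_cases h with ⟨p, hp, hpath⟩ | ⟨s, hs, i, hi, hrs, hns, hpath⟩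
    · rw [hpath, List.mem_singleton] at hm
      exact ⟨r, hr, by rw [hm], ⟨j, h, by rw [hpath, hm]; rfl⟩, .inl rfl⟩
    · rw [hpath, List.mem_cons] at hm
      rcases hm with hm | hm
      · exact ⟨r, hr, by rw [hm], ⟨j, h, by rw [hpath, hm]; rfl⟩, .inl rfl⟩
      · obtain ⟨u, hu, hid, hhead, hpre⟩ := ih i hi hs hns hm
        refine ⟨u, hu, hid, hhead, .inr ?_⟩
        rw [hpath]
        rcases hpre with rfl | ⟨w, hw, hwu, hmem⟩
        · exact ⟨r, hr, hrs, List.mem_cons_self⟩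
        · exact ⟨w, hw, hwu, List.mem_cons_of_mem _ hmem⟩

/-- The entry in question is the last one of the path. -/
theorem exists_holePort_mem_slidingPath {L : List Report} {j : ℕ} {r : Report} (hr : r ∈ L)
    (h : nearHole L j r = true) :
    ∃ s ∈ L, ∃ p, s.view.holePort = some p ∧ (s.id, p) ∈ slidingPath L j r := by
  induction j using Nat.strong_induction_on generalizing r with
  | _ j ih =>
    rcases slidingPath_cases h with ⟨p, hp, hpath⟩ | ⟨s, hs, i, hi, hrs, hns, hpath⟩
    · exact ⟨r, hr, p, hp, by simp [hpath]⟩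
    · obtain ⟨u, hu, p, hp, hmem⟩ := ih i hi hs hns
      exact ⟨u, hu, p, hp, by rw [hpath]; exact List.mem_cons_of_mem _ hmem⟩

end DISP
-- The effect of one round of DISP on the occupied nodes.
namespace Config

variable {V : Type*} {k : ℕ}

open DISP

/-- The port through which DISP moves agent `i`. -/
noncomputable def dispPort (c : Config V k) (H : PortGraph V) (i : Fin k) : Option ℕ :=
  DISP.port ((List.finRange k).map (c.report H)) (i + 1)

/-- The node of agent `i` after one round of DISP. -/
noncomputable def dispPos (c : Config V k) (H : PortGraph V) (i : Fin k) : V :=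
  moveFrom H (c.pos i) (c.dispPort H i)

/-- Some agent shares its node with agent `i`. -/
def OnMultinode (c : Config V k) (i : Fin k) : Prop := ∃ j, j ≠ i ∧ c.pos j = c.pos i

theorem one_lt_count_report (c : Config V k) (H : PortGraph V) (i : Fin k) :
    1 < (c.report H i).count ↔ c.OnMultinode i := by
  change 1 < (c.agentsAt (c.pos i)).card ↔ _
  rw [one_lt_card_agentsAt]
  constructor
  · rintro ⟨a, b, ha, hb, hab⟩
    by_cases h : a = i
    · exact ⟨b, by rintro rfl; exact hab h, hb⟩
    · exact ⟨a, h, ha⟩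
  · rintro ⟨j, hj, h⟩
    exact ⟨j, i, h, rfl, hj⟩

theorem exists_onMultinode (c : Config V k) :
    (∃ i, c.OnMultinode i) ↔ ¬ Function.Injective c.pos := by
  simp only [OnMultinode, Function.Injective, not_forall]
  constructor
  · rintro ⟨i, j, hj, h⟩
    exact ⟨j, i, h, hj⟩
  · rintro ⟨i, j, h, hij⟩
    exact ⟨j, i, hij, h⟩

/-- A path from an occupied node to a hole has at most as many steps before the hole as there are
occupied nodes. -/
theorem exists_nearHole_of_isPath (c : Config V k) (H : PortGraph V) {v h : V}
    (p : H.graph.Walk v h) (hp : p.IsPath) (hh : ∀ i, c.pos i ≠ h) (i : Fin k)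
    (hi : c.IsLeader i) (hv : c.pos i = v) :
    ∃ (j : ℕ) (F : Finset (Fin k)), nearHole (c.leaderReports H) j (c.report H i) = true ∧
      F.card = j + 1 ∧ ∀ a ∈ F, c.IsLeader a ∧ c.pos a ∈ p.support := by
  classical
  induction p generalizing i with
  | nil => exact absurd hv (hh i)
  | @cons v u h hvu q ih =>
    rw [SimpleGraph.Walk.cons_isPath_iff] at hp
    by_cases hu : ∀ a, c.pos a ≠ u
    · refine ⟨0, {i}, ?_, by simp, by simp [hi, hv]⟩
      exact isSome_holePort (v := c.pos i) (hv ▸ hvu) hu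
    · push Not at hu
      obtain ⟨a, ha⟩ := hu
      obtain ⟨s, hs, hsl⟩ := c.exists_isLeader a
      obtain ⟨j, F, hj, hF, hFs⟩ := ih hp.1 hh s hsl (hs.trans ha)
      -- `F` collects one leader for each occupied node met before the first hole, so its size
      -- bounds the search depth.
      refine ⟨j + 1, insert i F, ?_, ?_, ?_⟩
      · simp only [nearHole, Bool.or_eq_true, List.any_eq_true, Bool.and_eq_true]
        refine .inr ⟨c.report H s, (c.mem_leaderReports H _).2 ⟨s, hsl, rfl⟩, ?_, hj⟩
        rw [sees_report, hv, hs, ha]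
        exact hvu
      · rw [Finset.card_insert_of_notMem, hF]
        -- The path does not return to `v`, so the leaders are distinct.
        exact fun hiF => hp.2 (hv ▸ (hFs i hiF).2)
      · intro b hb
        rcases Finset.mem_insert.1 hb with rfl | hb
        · exact ⟨hi, by simp [hv]⟩
        · exact ⟨(hFs b hb).1, by simp [(hFs b hb).2]⟩

theorem card_le_length_leaderReports (c : Config V k) (H : PortGraph V) (F : Finset (Fin k))
    (hF : ∀ a ∈ F, c.IsLeader a) : F.card ≤ (c.leaderReports H).length := by
  classical
  have hsub : F.image (c.report H) ⊆ (c.leaderReports H).toFinset := by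
    intro r hr
    obtain ⟨a, ha, rfl⟩ := Finset.mem_image.1 hr
    exact List.mem_toFinset.2 ((c.mem_leaderReports H _).2 ⟨a, hF a ha, rfl⟩)
  have hinj : Function.Injective (c.report H) := by
    intro a b hab
    have : (a : ℕ) + 1 = b + 1 := congrArg Report.id hab
    exact Fin.ext (by omega)
  rw [← Finset.card_image_of_injective F hinj]
  exact (Finset.card_le_card hsub).trans (List.toFinset_card_le _)

/-- This justifies the search depth used by `DISP.port`: a path to a hole has at most one leader per
report before its first hole. -/
theorem nearHole_length (c : Config V k) (H : PortGraph V) (hH : H.graph.Connected) {h : V}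
    (hh : ∀ i, c.pos i ≠ h) {r : Report} (hr : r ∈ c.leaderReports H) :
    nearHole (c.leaderReports H) (c.leaderReports H).length r = true := by
  obtain ⟨i, hi, rfl⟩ := (c.mem_leaderReports H r).1 hr
  obtain ⟨p, hp⟩ := (hH.preconnected (c.pos i) h).exists_isPath
  obtain ⟨j, F, hj, hF, hFl⟩ := c.exists_nearHole_of_isPath H p hp hh i hi rfl
  have := c.card_le_length_leaderReports H F fun a ha => (hFl a ha).1
  exact (nearHole_slidingPath_mono (by omega) hj).1

/-- The moves that one round of DISP consists of: pairs of an identifier and a port. -/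
noncomputable def dispMoves (c : Config V k) (H : PortGraph V) : List (ℕ × ℕ) :=
  ((c.leaderReports H).filter (isRoot (c.leaderReports H))).flatMap
    (slidingPath (c.leaderReports H) (c.leaderReports H).length)

theorem mem_dispMoves (c : Config V k) (H : PortGraph V) (m : ℕ × ℕ) :
    m ∈ c.dispMoves H ↔ ∃ r ∈ c.leaderReports H, isRoot (c.leaderReports H) r = true ∧
      m ∈ slidingPath (c.leaderReports H) (c.leaderReports H).length r := by
  simp [dispMoves, and_assoc]

theorem dispPort_eq (c : Config V k) (H : PortGraph V) (i : Fin k) :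
    c.dispPort H i =
      ((c.dispMoves H).find? fun m => decide (m.1 = (i : ℕ) + 1)).map Prod.snd := rfl

theorem eq_of_report_id {c : Config V k} {H : PortGraph V} {i j : Fin k}
    (h : (c.report H i).id = (j : ℕ) + 1) : i = j :=
  Fin.ext (by have : (i : ℕ) + 1 = j + 1 := h; omega)

/-- The alternative says how the node left by a moving agent stays occupied: at the start of a path
it is a multinode, and further along the predecessor moves onto it. -/
theorem isLeader_of_mem_dispMoves {c : Config V k} {H : PortGraph V} (hH : H.graph.Connected)
    {h : V} (hh : ∀ i, c.pos i ≠ h) {i : Fin k} {p : ℕ} (hm : ((i : ℕ) + 1, p) ∈ c.dispMoves H) :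
    c.IsLeader i ∧ (c.OnMultinode i ∨ ∃ u, H.graph.Adj (c.pos u) (c.pos i) ∧
      ((u : ℕ) + 1, (c.report H u).portTo (c.report H i)) ∈ c.dispMoves H) := by
  obtain ⟨r, hr, hroot, hm⟩ := (c.mem_dispMoves H _).1 hm
  obtain ⟨s, hs, hid, -, hpre⟩ := mem_slidingPath hr (c.nearHole_length H hH hh hr) hm
  obtain ⟨a, ha, rfl⟩ := (c.mem_leaderReports H _).1 hs
  obtain rfl := eq_of_report_id hid
  refine ⟨ha, ?_⟩
  rcases hpre with rfl | ⟨u, hu, hua, hmem⟩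
  · left
    rw [isRoot, Bool.and_eq_true, decide_eq_true_iff, one_lt_count_report] at hroot
    exact hroot.1
  · right
    obtain ⟨b, -, rfl⟩ := (c.mem_leaderReports H _).1 hu
    exact ⟨b, (sees_report _ _ _ _).1 hua, (c.mem_dispMoves H _).2 ⟨r, hr, hroot, hmem⟩⟩

/-- Each entry is the head of the sliding path from its own node, and that path does not depend on
the bound. So paths of different roots never give an agent conflicting orders, and disjointness of
the components is not needed. -/
theorem dispMoves_functional {c : Config V k} {H : PortGraph V} (hH : H.graph.Connected)
    {h : V} (hh : ∀ i, c.pos i ≠ h) {m m' : ℕ × ℕ} (hm : m ∈ c.dispMoves H)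
    (hm' : m' ∈ c.dispMoves H) (hmm' : m.1 = m'.1) : m = m' := by
  obtain ⟨r, hr, -, hm⟩ := (c.mem_dispMoves H _).1 hm
  obtain ⟨r', hr', -, hm'⟩ := (c.mem_dispMoves H _).1 hm'
  obtain ⟨s, hs, hid, ⟨i, hi, him⟩, -⟩ := mem_slidingPath hr (c.nearHole_length H hH hh hr) hm
  obtain ⟨s', hs', hid', ⟨i', hi', him'⟩, -⟩ :=
    mem_slidingPath hr' (c.nearHole_length H hH hh hr') hm'
  obtain ⟨a, ha, rfl⟩ := (c.mem_leaderReports H _).1 hs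
  obtain ⟨a', ha', rfl⟩ := (c.mem_leaderReports H _).1 hs'
  obtain rfl : a = a' := eq_of_report_id (hid.trans (hmm'.trans hid'.symm))
  rw [slidingPath_congr hi hi', him'] at him
  exact (Option.some.inj him).symm

theorem dispPos_of_mem {c : Config V k} {H : PortGraph V} (hH : H.graph.Connected)
    {h : V} (hh : ∀ i, c.pos i ≠ h) {i : Fin k} {p : ℕ} (hm : ((i : ℕ) + 1, p) ∈ c.dispMoves H) :
    c.dispPos H i = moveFrom H (c.pos i) (some p) := by
  rw [dispPos, dispPort_eq]
  cases hf : (c.dispMoves H).find? fun m => decide (m.1 = (i : ℕ) + 1) with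
  | none =>
    rw [List.find?_eq_none] at hf
    exact absurd (decide_eq_true rfl) (hf _ hm)
  | some m =>
    have hid : m.1 = (i : ℕ) + 1 := by simpa using List.find?_some hf
    have := dispMoves_functional hH hh (List.mem_of_find?_eq_some hf) hm hid
    rw [this]
    rfl

theorem dispPos_of_notMem {c : Config V k} {H : PortGraph V} {i : Fin k}
    (hm : ∀ p, ((i : ℕ) + 1, p) ∉ c.dispMoves H) : c.dispPos H i = c.pos i := by
  have hf : (c.dispMoves H).find? (fun m => decide (m.1 = (i : ℕ) + 1)) = none := by
    rw [List.find?_eq_none]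
    rintro ⟨a, p⟩ hap he
    obtain rfl : a = (i : ℕ) + 1 := of_decide_eq_true he
    exact hm p hap
  rw [dispPos, dispPort_eq, hf]
  rfl

/-- In a round of DISP at most the agent with the least identifier leaves a node. -/
theorem dispPos_of_not_isLeader {c : Config V k} {H : PortGraph V} (hH : H.graph.Connected)
    {h : V} (hh : ∀ i, c.pos i ≠ h) {i : Fin k} (hi : ¬ c.IsLeader i) :
    c.dispPos H i = c.pos i :=
  dispPos_of_notMem fun _ hm => hi (isLeader_of_mem_dispMoves hH hh hm).1

/-- A round of DISP keeps occupied nodes occupied. -/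
theorem exists_dispPos_eq {c : Config V k} {H : PortGraph V} (hH : H.graph.Connected)
    {h : V} (hh : ∀ i, c.pos i ≠ h) (i : Fin k) : ∃ j, c.dispPos H j = c.pos i := by
  by_cases hm : ∃ p, ((i : ℕ) + 1, p) ∈ c.dispMoves H
  · obtain ⟨p, hm⟩ := hm
    obtain ⟨hi, ⟨j, hj, hji⟩ | ⟨u, hui, hu⟩⟩ := isLeader_of_mem_dispMoves hH hh hm
    -- On a multinode the leader `i` may leave, but any other agent `j` there is not a leader and
    -- stays.
    · refine ⟨j, (dispPos_of_not_isLeader hH hh fun hjl => hj (hjl.eq hi hji)).trans hji⟩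
    · exact ⟨u, (dispPos_of_mem hH hh hu).trans (c.moveFrom_portTo H u i hui)⟩
  · exact ⟨i, dispPos_of_notMem fun p hp => hm ⟨p, hp⟩⟩

/-- The least of all agents on multinodes is also least in its own component, so `joined` need not
be analysed. -/
theorem exists_isRoot (c : Config V k) (H : PortGraph V) (hc : ¬ Function.Injective c.pos) :
    ∃ r ∈ c.leaderReports H, isRoot (c.leaderReports H) r = true := by
  classical
  let S := Finset.univ.filter fun i => c.OnMultinode i
  have hS : S.Nonempty := by
    obtain ⟨i, hi⟩ := c.exists_onMultinode.2 hc
    exact ⟨i, by simpa [S] using hi⟩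
  have hmem : c.OnMultinode (S.min' hS) := by simpa [S] using S.min'_mem hS
  have hmin : ∀ j, c.OnMultinode j → S.min' hS ≤ j := fun j hj =>
    S.min'_le j (by simpa [S] using hj)
  refine ⟨c.report H (S.min' hS), (c.mem_leaderReports H _).2 ⟨_, ?_, rfl⟩, ?_⟩
  · intro j hj
    by_cases hj' : j = S.min' hS
    · exact hj'.ge
    · exact hmin j ⟨S.min' hS, Ne.symm hj', hj.symm⟩
  · rw [isRoot, Bool.and_eq_true, decide_eq_true_iff, one_lt_count_report, List.all_eq_true]
    refine ⟨hmem, fun s hs => ?_⟩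
    obtain ⟨j, -, rfl⟩ := (c.mem_leaderReports H _).1 hs
    by_cases hj : c.OnMultinode j
    · rw [Bool.or_eq_true]
      exact .inr (decide_eq_true (Nat.succ_le_succ (hmin j hj)))
    · rw [← c.one_lt_count_report H] at hj
      simp [hj]

/-- If there is a multinode, then a round of DISP fills some hole. -/
theorem exists_dispPos_hole {c : Config V k} {H : PortGraph V} (hH : H.graph.Connected)
    {h : V} (hh : ∀ i, c.pos i ≠ h) (hc : ¬ Function.Injective c.pos) :
    ∃ j, ∀ i, c.pos i ≠ c.dispPos H j := by
  obtain ⟨r, hr, hroot⟩ := c.exists_isRoot H hc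
  obtain ⟨s, hs, p, hp, hm⟩ := exists_holePort_mem_slidingPath hr (c.nearHole_length H hH hh hr)
  obtain ⟨j, -, rfl⟩ := (c.mem_leaderReports H _).1 hs
  refine ⟨j, ?_⟩
  rw [dispPos_of_mem hH hh ((c.mem_dispMoves H _).2 ⟨r, hr, hroot, hm⟩)]
  exact moveFrom_holePort hp

/-- The progress measure behind the upper bound on the running time. -/
theorem card_image_pos_lt_card_image_dispPos [DecidableEq V] {c : Config V k} {H : PortGraph V}
    (hH : H.graph.Connected) {h : V} (hh : ∀ i, c.pos i ≠ h) (hc : ¬ Function.Injective c.pos) :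
    (Finset.univ.image c.pos).card < (Finset.univ.image (c.dispPos H)).card := by
  refine Finset.card_lt_card ((Finset.ssubset_iff_of_subset ?_).2 ?_)
  · intro v hv
    obtain ⟨i, -, rfl⟩ := Finset.mem_image.1 hv
    obtain ⟨j, hj⟩ := exists_dispPos_eq hH hh i
    exact Finset.mem_image.2 ⟨j, Finset.mem_univ _, hj⟩
  · obtain ⟨j, hj⟩ := exists_dispPos_hole hH hh hc
    exact ⟨c.dispPos H j, Finset.mem_image_of_mem _ (Finset.mem_univ _), by simpa using hj⟩

/-- Only the leader of `v` can leave `v`. This drives the lower bound on the running time. -/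
theorem card_filter_pos_le [DecidableEq V] {c : Config V k} {H : PortGraph V}
    (hH : H.graph.Connected) {h : V} (hh : ∀ i, c.pos i ≠ h) (v : V) :
    (Finset.univ.filter fun i => c.pos i = v).card ≤
      (Finset.univ.filter fun i => c.dispPos H i = v).card + 1 := by
  by_cases hv : ∃ i, c.pos i = v
  · obtain ⟨i, rfl⟩ := hv
    obtain ⟨a, ha, hal⟩ := c.exists_isLeader i
    refine le_trans (Finset.card_le_card ?_) (Finset.card_insert_le a _)
    intro j hj
    have hj : c.pos j = c.pos i := by simpa using hj
    by_cases hja : j = a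
    · simp [hja]
    · have : ¬ c.IsLeader j := fun hjl => hja (hjl.eq hal (hj.trans ha.symm))
      simp [dispPos_of_not_isLeader hH hh this, hj]
  · push Not at hv
    simp [Finset.filter_false_of_mem fun i _ => hv i]

end Config
-- One round of the exploration algorithm.
theorem decodeId_bits (a : ℕ) : decodeId (Nat.bits a) = a := by
  induction a using Nat.binaryRec' with
  | zero => simp [decodeId]
  | bit b m h ih =>
    rw [Nat.bits_append_bit _ _ h]
    simpa [decodeId] using congrArg (Nat.bit b) ih

theorem DynamicGraph.IntervalConnected.connected {V : Type*} {G : DynamicGraph V}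
    (hG : G.IntervalConnected 1) (r : ℕ) : (G r).graph.Connected := by
  simpa using hG r

namespace Config

variable {V : Type*} {k : ℕ}

/-- No agent has terminated, and every agent remembers exactly its identifier. -/
structure IsActive (c : Config V k) : Prop where
  mem : ∀ i : Fin k, c.mem i = Nat.bits (i + 1)
  halted : ∀ i, c.halted i = false

section

variable {c : Config V k} {H : PortGraph V}

/-- Connectivity gives all agents the same messages, so they all take the same branch of the
algorithm. -/
theorem IsActive.received_eq (hc : c.IsActive) (hH : H.graph.Connected) (i : Fin k) :
    c.received explorationAlgorithm H i = (List.finRange k).map (c.report H) := by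
  rw [received, List.filter_eq_self.2]
  · refine List.map_congr_left fun j _ => ?_
    simp [explorationAlgorithm, report, hc.mem, decodeId_bits]
  · intro j _
    simpa using ⟨hc.halted j, hH.preconnected _ _⟩

theorem IsActive.decision_of_not_injective (hc : c.IsActive) (hH : H.graph.Connected)
    (hinj : ¬ Function.Injective c.pos) (i : Fin k) :
    c.decision explorationAlgorithm H i = ⟨c.mem i, c.dispPort H i, false⟩ := by
  obtain ⟨j, hj⟩ := c.exists_onMultinode.2 hinj
  have h : ((List.finRange k).map (c.report H)).any (fun r => decide (1 < r.count)) = true :=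
    List.any_eq_true.2 ⟨_, List.mem_map_of_mem (List.mem_finRange j),
      decide_eq_true ((c.one_lt_count_report H j).2 hj)⟩
  rw [decision, hc.received_eq hH]
  simp only [explorationAlgorithm]
  rw [if_pos (by rw [h, Bool.or_true]), hc.mem, decodeId_bits]
  rfl

theorem IsActive.decision_of_injective (hc : c.IsActive) (hH : H.graph.Connected)
    (hinj : Function.Injective c.pos) (i : Fin k) :
    c.decision explorationAlgorithm H i = ⟨c.mem i, (c.viewAt H (c.pos i)).holePort, true⟩ := by
  have hm : ∀ j, ¬ 1 < (c.report H j).count := fun j hj =>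
    c.exists_onMultinode.1 ⟨j, (c.one_lt_count_report H j).1 hj⟩ hinj
  have h : ((List.finRange k).map (c.report H)).any (fun r => decide (1 < r.count)) = false := by
    simp only [List.any_eq_false, List.mem_map]
    rintro _ ⟨j, -, rfl⟩
    simpa using hm j
  have h' : ¬ 1 < (c.viewAt H (c.pos i)).here.card := hm i
  rw [decision, hc.received_eq hH]
  simp only [explorationAlgorithm]
  rw [if_neg (by rw [h, Bool.or_false, decide_eq_true_iff]; exact h')]

theorem IsActive.next_of_not_injective (hc : c.IsActive) (hH : H.graph.Connected)
    (hinj : ¬ Function.Injective c.pos) :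
    (c.next explorationAlgorithm H).IsActive ∧
      (c.next explorationAlgorithm H).pos = c.dispPos H := by
  refine ⟨⟨fun i => ?_, fun i => ?_⟩, funext fun i => ?_⟩ <;>
    simp [next, hc.halted, hc.decision_of_not_injective hH hinj, hc.mem, dispPos]

theorem IsActive.halted_next (hc : c.IsActive) (hH : H.graph.Connected)
    (hinj : Function.Injective c.pos) (i : Fin k) :
    (c.next explorationAlgorithm H).halted i = true := by
  simp [next, hc.halted, hc.decision_of_injective hH hinj]

/-- The dispersed agents next to the only hole move into it. -/
theorem IsActive.exists_next_pos_eq [Fintype V] (hc : c.IsActive) (hH : H.graph.Connected)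
    (hinj : Function.Injective c.pos) (hk : Fintype.card V = k + 1) (hk0 : 0 < k) {h : V}
    (hh : ∀ i, c.pos i ≠ h) : ∃ i, (c.next explorationAlgorithm H).pos i = h := by
  classical
  have huniq : ∀ w, (∀ i, c.pos i ≠ w) → w = h := by
    intro w hw
    -- Dispersed agents occupy `k` of the `k + 1` nodes.
    have hcard : (Finset.univ.image c.pos)ᶜ.card = 1 := by
      rw [Finset.card_compl, Finset.card_image_of_injective _ hinj, hk]
      simp
    exact Finset.card_le_one.1 hcard.le w (by simpa using hw) h (by simpa using hh)
  have : Nontrivial V := Fintype.one_lt_card_iff_nontrivial.1 (by omega)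
  obtain ⟨v, hv⟩ := hH.preconnected.exists_adj_of_nontrivial h
  -- A neighbour of the only hole is a different node, hence occupied.
  have hocc : ∃ i, c.pos i = v := by
    by_contra! hv'
    exact hv.ne (huniq v hv').symm
  obtain ⟨i, rfl⟩ := hocc
  obtain ⟨p, hp⟩ := Option.isSome_iff_exists.1 (isSome_holePort hv.symm hh)
  refine ⟨i, ?_⟩
  simp only [next, hc.halted, hc.decision_of_injective hH hinj, hp]
  exact huniq _ (moveFrom_holePort hp)

end

end Config

/-! ### The whole run: dispersion time and termination. -/

namespace AgentAlgorithm

open Config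

variable {V : Type*} {k : ℕ}

theorem mem_run_exploration (G : DynamicGraph V) (start : Fin k → V) (r : ℕ) (i : Fin k) :
    (explorationAlgorithm.run G start r).mem i = Nat.bits (i + 1) := by
  induction r with
  | zero => rfl
  | succ r ih =>
    have h : ∀ m w l, (explorationAlgorithm.compute m w l).mem = m := by
      intro m w l
      simp only [explorationAlgorithm]
      split_ifs <;> rfl
    simp only [run, next, decision, h, ih, ite_self]

variable {G : DynamicGraph V} {start : Fin k → V}

theorem isActive_run (hG : G.IntervalConnected 1) {r : ℕ}
    (h : ∀ q < r, ¬ Function.Injective (explorationAlgorithm.run G start q).pos) :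
    (explorationAlgorithm.run G start r).IsActive := by
  induction r with
  | zero => exact ⟨fun _ => rfl, fun _ => rfl⟩
  | succ r ih =>
    exact ((ih fun q hq => h q (by omega)).next_of_not_injective (hG.connected r)
      (h r (by omega))).1

theorem pos_run_succ (hG : G.IntervalConnected 1) {r : ℕ}
    (h : ∀ q ≤ r, ¬ Function.Injective (explorationAlgorithm.run G start q).pos) :
    (explorationAlgorithm.run G start (r + 1)).pos =
      (explorationAlgorithm.run G start r).dispPos (G r) :=
  ((isActive_run hG fun q hq => h q hq.le).next_of_not_injective (hG.connected r)
    (h r le_rfl)).2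

/-- Dispersion at time `s` is noticed during round `s`, which costs one more round. Minimality needs
an agent that is still active before, hence `0 < k`. -/
theorem runningTime_succ (hG : G.IntervalConnected 1) (hk0 : 0 < k) {s : ℕ}
    (hs : Function.Injective (explorationAlgorithm.run G start s).pos)
    (h : ∀ q < s, ¬ Function.Injective (explorationAlgorithm.run G start q).pos) :
    explorationAlgorithm.RunningTime G start (s + 1) := by
  refine ⟨(isActive_run hG h).halted_next (hG.connected s) hs, fun t ht => ?_⟩
  by_contra! hts
  have := (isActive_run hG fun q hq => h q (by omega) : (run _ G start t).IsActive).halted ⟨0, hk0⟩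
  simp [ht ⟨0, hk0⟩] at this

variable [Fintype V]

theorem exists_hole (hk : k < Fintype.card V) (f : Fin k → V) : ∃ h, ∀ i, f i ≠ h := by
  by_contra! hf
  have := Fintype.card_le_of_surjective f hf
  rw [Fintype.card_fin] at this
  omega

/-- One node is occupied at the start, and each round with a multinode adds at least one. -/
theorem lt_card_image_pos_run [DecidableEq V] (hG : G.IntervalConnected 1)
    (hk : k < Fintype.card V) (hk0 : 0 < k) {r : ℕ}
    (h : ∀ q < r, ¬ Function.Injective (explorationAlgorithm.run G start q).pos) :
    r < (Finset.univ.image (explorationAlgorithm.run G start r).pos).card := by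
  induction r with
  | zero => exact Finset.card_pos.2 ⟨_, Finset.mem_image_of_mem _ (Finset.mem_univ ⟨0, hk0⟩)⟩
  | succ r ih =>
    obtain ⟨w, hw⟩ := exists_hole hk (explorationAlgorithm.run G start r).pos
    rw [pos_run_succ hG fun q hq => h q (by omega)]
    exact (Nat.succ_le_of_lt (ih fun q hq => h q (by omega))).trans_lt
      (card_image_pos_lt_card_image_dispPos (hG.connected r) hw (h r (by omega)))

/-- The agents are dispersed after fewer than `k` rounds of DISP. -/
theorem exists_first_injective (hG : G.IntervalConnected 1) (hk : k < Fintype.card V)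
    (hk0 : 0 < k) :
    ∃ s < k, Function.Injective (explorationAlgorithm.run G start s).pos ∧
      ∀ q < s, ¬ Function.Injective (explorationAlgorithm.run G start q).pos := by
  classical
  have hcard : ∀ r, (Finset.univ.image (explorationAlgorithm.run G start r).pos).card ≤ k :=
    fun r => Finset.card_image_le.trans (by simp)
  have hex : ∃ s, Function.Injective (explorationAlgorithm.run G start s).pos := by
    by_contra! hno
    exact absurd ((lt_card_image_pos_run hG hk hk0 fun q _ => hno q).trans_le (hcard k))
      (lt_irrefl k)
  have hmin : ∀ q < Nat.find hex, ¬ Function.Injective (explorationAlgorithm.run G start q).pos :=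
    fun q hq => Nat.find_min hex hq
  exact ⟨Nat.find hex, (lt_card_image_pos_run hG hk hk0 hmin).trans_le (hcard _),
    Nat.find_spec hex, hmin⟩

/-- All `k` agents start on `v`, and at most one leaves per round. -/
theorem le_card_filter_pos_run_add [DecidableEq V] (hG : G.IntervalConnected 1)
    (hk : k < Fintype.card V) (v : V) {r : ℕ}
    (h : ∀ q < r, ¬ Function.Injective (explorationAlgorithm.run G (fun _ : Fin k => v) q).pos) :
    k ≤ (Finset.univ.filter fun i =>
      (explorationAlgorithm.run G (fun _ : Fin k => v) r).pos i = v).card + r := by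
  induction r with
  | zero => simp [run]
  | succ r ih =>
    obtain ⟨w, hw⟩ := exists_hole hk (explorationAlgorithm.run G (fun _ : Fin k => v) r).pos
    have := card_filter_pos_le (hG.connected r) hw v
    rw [pos_run_succ hG fun q hq => h q (by omega)]
    have := ih fun q hq => h q (by omega)
    omega

end AgentAlgorithm

/-! ### Worst-case instance, memory bound and the main theorem. -/

/-- The complete graph, with the ports of each node in the order of a fixed list of all nodes. -/
noncomputable def PortGraph.complete (V : Type*) [Fintype V] [DecidableEq V] : PortGraph V where
  graph := ⊤
  nbrs v := (Finset.univ.erase v).toList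
  nodup_nbrs _ := Finset.nodup_toList _
  mem_nbrs v w := by simp [eq_comm]

theorem DynamicGraph.intervalConnected_complete (V : Type*) [Fintype V] [DecidableEq V]
    [Nonempty V] : DynamicGraph.IntervalConnected (fun _ => PortGraph.complete V) 1 := by
  intro r
  simp [PortGraph.complete]

theorem Nat.length_bits_le_logb {a n : ℕ} (hn : 2 ≤ n) (ha : a ≤ n) :
    ((Nat.bits a).length : ℝ) + 1 ≤ 3 * Real.logb 2 n := by
  have hlog : Nat.log 2 n ≤ Real.logb 2 n := Real.natLog_le_logb n 2
  have hone : 1 ≤ Nat.log 2 n := Nat.log_pos (by norm_num) hn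
  have hsize : (Nat.bits a).length ≤ Nat.log 2 n + 1 := by
    rw [Nat.size_eq_bits_len, Nat.size_le]
    exact ha.trans_lt (Nat.lt_pow_succ_log_self (by norm_num) n)
  have h1 : (1 : ℝ) ≤ Nat.log 2 n := by exact_mod_cast hone
  have h2 : ((Nat.bits a).length : ℝ) ≤ Nat.log 2 n + 1 := by exact_mod_cast hsize
  linarith

theorem mainTheorem3 :
    ∃ c C : ℝ, 0 < c ∧ 0 < C ∧
      ∀ (n : ℕ), 2 ≤ n → ∀ (V : Type*) [Fintype V], Fintype.card V = n →
        -- exploration with termination, in `O(n)` rounds and with `O(log n)` bits per agent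
        (∀ G : DynamicGraph V, G.IntervalConnected 1 → ∀ start : Fin (n - 1) → V,
          ∃ t : ℕ, explorationAlgorithm.RunningTime G start t ∧ (t : ℝ) ≤ C * n ∧
            explorationAlgorithm.ExploresBy G start t ∧
            (∀ (r : ℕ) (i : Fin (n - 1)),
              ((explorationAlgorithm.run G start r).bits i : ℝ) ≤ C * Real.logb 2 n) ∧
            -- in the last round the agents are dispersed, and they move into the remaining hole
            ∃ s : ℕ, t = s + 1 ∧
              Function.Injective (explorationAlgorithm.run G start s).pos ∧
              ∀ v : V, (∀ i, (explorationAlgorithm.run G start s).pos i ≠ v) →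
                ∃ i, (explorationAlgorithm.run G start (s + 1)).pos i = v) ∧
        -- in the worst case the number of rounds is also `Ω(n)`
        (∃ G : DynamicGraph V, G.IntervalConnected 1 ∧ ∃ (start : Fin (n - 1) → V) (t : ℕ),
          explorationAlgorithm.RunningTime G start t ∧ c * n ≤ (t : ℝ)) := by
  classical
  -- The constant 3 is needed for the memory only: at most `log n + 1` bits for an identifier and
  -- one for termination, where `log n ≥ 1`. The constant `1 / 2` comes from `t ≥ n - 1 ≥ n / 2`.
  refine ⟨1 / 2, 3, by norm_num, by norm_num, fun n hn V _ hV => ⟨fun G hG start => ?_, ?_⟩⟩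
  · obtain ⟨s, hsk, hs, hmin⟩ := AgentAlgorithm.exists_first_injective (start := start) hG
      (by omega) (by omega)
    have hactive := AgentAlgorithm.isActive_run hG hmin
    have hlast : ∀ v : V, (∀ i, (explorationAlgorithm.run G start s).pos i ≠ v) →
        ∃ i, (explorationAlgorithm.run G start (s + 1)).pos i = v := fun v hv =>
      hactive.exists_next_pos_eq (hG.connected s) hs (by omega) (by omega) hv
    refine ⟨s + 1, AgentAlgorithm.runningTime_succ hG (by omega) hs hmin, ?_, fun v => ?_,
      fun r i => ?_, s, rfl, hs, hlast⟩
    · have h : s + 1 ≤ 3 * n := by omega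
      exact_mod_cast h
    -- The last two configurations already cover all nodes.
    · by_cases hv : ∃ i, (explorationAlgorithm.run G start s).pos i = v
      · exact ⟨s, Nat.le_succ s, hv⟩
      · push Not at hv
        exact ⟨s + 1, le_rfl, hlast v hv⟩
    · rw [Config.bits, AgentAlgorithm.mem_run_exploration]
      push_cast
      exact Nat.length_bits_le_logb hn (by omega)
  · have : Nonempty V := Fintype.card_pos_iff.1 (by omega)
    obtain ⟨v⟩ := this
    have : Nonempty V := ⟨v⟩
    have hG := DynamicGraph.intervalConnected_complete V
    obtain ⟨s, -, hs, hmin⟩ := AgentAlgorithm.exists_first_injective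
      (start := fun _ : Fin (n - 1) => v) hG (by omega) (by omega)
    -- The complete graph serves only as a concrete instance; the estimate below holds for every
    -- 1-Interval Connected dynamic graph.
    refine ⟨_, hG, _, s + 1, AgentAlgorithm.runningTime_succ hG (by omega) hs hmin, ?_⟩
    have hle := AgentAlgorithm.le_card_filter_pos_run_add hG (by omega) v hmin
    have hone : (Finset.univ.filter fun i => (explorationAlgorithm.run
        (fun _ => PortGraph.complete V) (fun _ : Fin (n - 1) => v) s).pos i = v).card ≤ 1 := by
      refine Finset.card_le_one.2 fun a ha b hb => hs ?_
      rw [(Finset.mem_filter.1 ha).2, (Finset.mem_filter.1 hb).2]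
    -- At time `s` at most one agent is left on `v`, so `n - 1 ≤ 1 + s`.
    have h : n ≤ 2 * (s + 1) := by omega
    have h' : (n : ℝ) ≤ 2 * ((s + 1 : ℕ) : ℝ) := by exact_mod_cast h
    linarith
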